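/- Let $n\ge 2$ and let $H\le \mathrm{SO}(n)$ be a closed subgroup. Let $\mathfrak h\le\mathfrak{so}(n)$ be its Lie algebra, i.e. $\mathfrak h=\{A\in\mathbb R^{n\times n} : \exp(tA)\in H \text{ for all } t\in\mathbb R\}$. For $x\in\mathbb R^n$ put $\operatorname{rank}_x\mathfrak h:=\dim\{Ax : A\in\mathfrak h\}$. Then the natural action of $H$ on the unit sphere $S^{n-1}\subset\mathbb R^n$, by matrix multiplication, is transitive if and only if $\operatorname{rank}_x\mathfrak h=n-1$ for some $x\in S^{n-1}$. -/

import Mathlib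

attribute [local instance] LieRing.ofAssociativeRing

noncomputable section

namespace SphereAction

open Matrix

/-- The special orthogonal group `SO(n)`. -/
abbrev SO (n : ℕ) : Type := Matrix.specialOrthogonalGroup (Fin n) ℝ

/-- The unit sphere `S^{n-1}` in Euclidean space `ℝⁿ`. -/
abbrev Sphere (n : ℕ) : Type := Metric.sphere (0 : EuclideanSpace ℝ (Fin n)) 1

/-- The product `A x` of a matrix and a vector of Euclidean space. -/
def mulVecE {n : ℕ} (A : Matrix (Fin n) (Fin n) ℝ) (x : EuclideanSpace ℝ (Fin n)) :
    EuclideanSpace ℝ (Fin n) :=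
  WithLp.toLp 2 (A *ᵥ x.ofLp)

theorem norm_mulVecE {n : ℕ} (g : SO n) (x : EuclideanSpace ℝ (Fin n)) :
    ‖mulVecE (g : Matrix (Fin n) (Fin n) ℝ) x‖ = ‖x‖ := by
  have hg : (g : Matrix (Fin n) (Fin n) ℝ)ᵀ * (g : Matrix (Fin n) (Fin n) ℝ) = 1 :=
    (Matrix.mem_orthogonalGroup_iff' (Fin n) ℝ).1
      ((Matrix.mem_specialOrthogonalGroup_iff).1 g.2).1
  have key : ∀ v : EuclideanSpace ℝ (Fin n), ‖v‖ ^ 2 = v.ofLp ⬝ᵥ v.ofLp := by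
    intro v
    rw [EuclideanSpace.norm_sq_eq]
    simp [dotProduct, sq]
  have h2 : ‖mulVecE (g : Matrix (Fin n) (Fin n) ℝ) x‖ ^ 2 = ‖x‖ ^ 2 := by
    rw [key, key]
    simp only [mulVecE]
    rw [Matrix.dotProduct_mulVec, Matrix.vecMul_mulVec, hg, Matrix.vecMul_one]
  exact (sq_eq_sq₀ (norm_nonneg _) (norm_nonneg _)).1 h2

/-- The natural action of `SO(n)` on the unit sphere by matrix multiplication. -/
instance sphereAction (n : ℕ) : MulAction (SO n) (Sphere n) where
  smul g x := ⟨mulVecE (g : Matrix (Fin n) (Fin n) ℝ) x.1, by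
    rw [mem_sphere_zero_iff_norm, norm_mulVecE]
    exact mem_sphere_zero_iff_norm.1 x.2⟩
  one_smul x := by
    apply Subtype.ext
    change mulVecE (1 : Matrix (Fin n) (Fin n) ℝ) x.1 = x.1
    simp [mulVecE]
  mul_smul g k x := by
    apply Subtype.ext
    change mulVecE ((g : Matrix (Fin n) (Fin n) ℝ) * (k : Matrix (Fin n) (Fin n) ℝ)) x.1 =
      mulVecE (g : Matrix (Fin n) (Fin n) ℝ) (mulVecE (k : Matrix (Fin n) (Fin n) ℝ) x.1)
    simp [mulVecE]

/-- The Lie algebra `h` is the Lie algebra of the subgroup `H` of `SO(n)`: it consists of exactly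
those matrices `A` whose one-parameter group `exp (t A)`, `t ∈ ℝ`, lies in `H`. -/
def IsLieAlgebraOf {n : ℕ} (h : LieSubalgebra ℝ (Matrix (Fin n) (Fin n) ℝ))
    (H : Subgroup (SO n)) : Prop :=
  ∀ A : Matrix (Fin n) (Fin n) ℝ,
    A ∈ h ↔ ∀ t : ℝ, ∃ g ∈ H, (g : Matrix (Fin n) (Fin n) ℝ) = NormedSpace.exp (t • A)

/-- The evaluation map `A ↦ A x`. -/
def evalAt {n : ℕ} (x : EuclideanSpace ℝ (Fin n)) :
    Matrix (Fin n) (Fin n) ℝ →ₗ[ℝ] EuclideanSpace ℝ (Fin n) where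
  toFun A := mulVecE A x
  map_add' A B := by simp [mulVecE, Matrix.add_mulVec]
  map_smul' c A := by simp [mulVecE, Matrix.smul_mulVec]

/-- The rank of a Lie algebra `h` of matrices at `x`: the dimension of `{A x : A ∈ h}`. -/
def rankAt {n : ℕ} (h : LieSubalgebra ℝ (Matrix (Fin n) (Fin n) ℝ))
    (x : EuclideanSpace ℝ (Fin n)) : ℕ :=
  Module.finrank ℝ (Submodule.map (evalAt x) h.toSubmodule)

end SphereAction

end

/-! Both directions compare the orbit of `x` with the vectors `A x`, `A ∈ h`. These are orthogonal
to `x` because `h` is skew, so the rank is at most `n - 1`.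

If `H` is transitive, split `h` into the part killing `x` and a complement `m`, whose dimension is
at most the rank. As in the closed subgroup theorem (`eventually_eq_zero_of_exp_mem`), elements of
`H` near `1` move `x` as elements of `exp m` do. Countably many translates cover `H`, so ℝⁿ is a
countable union of C¹ images of `ℝ × m`, and Hausdorff dimension gives `n ≤ 1 + dim m`.

If the rank at `x` is `n - 1`, the cone over `exp(h) x` is a neighbourhood of `x`
(`cone_exp_mem_nhds`), so the orbit is open. It is closed by compactness, and the sphere is
connected for `n ≥ 2`. -/

noncomputable section

namespace SphereAction

open Filter Topology NormedSpace

/-! ### Exponentials in finite-dimensional algebras -/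

section BanachAlgebra

variable {𝔸 : Type*} [NormedRing 𝔸] [NormedAlgebra ℝ 𝔸]

/-- If a sequence of nonzero vectors tends to `0` with limiting direction `u`, then suitable integer
multiples of it tend to any prescribed multiple of `u`. -/
theorem tendsto_floor_smul {E : Type*} [NormedAddCommGroup E] [NormedSpace ℝ E] {c : ℕ → E} {u : E}
    (hc : Tendsto c atTop (𝓝 0)) (hne : ∀ j, c j ≠ 0)
    (hu : Tendsto (fun j => ‖c j‖⁻¹ • c j) atTop (𝓝 u)) (t : ℝ) :
    Tendsto (fun j => ⌊t / ‖c j‖⌋ • c j) atTop (𝓝 (t • u)) := by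
  have hnorm : Tendsto (fun j => ‖c j‖) atTop (𝓝 0) := by simpa using hc.norm
  have hpos : ∀ j, 0 < ‖c j‖ := fun j => norm_pos_iff.2 (hne j)
  have hcoef : Tendsto (fun j => (⌊t / ‖c j‖⌋ : ℝ) * ‖c j‖) atTop (𝓝 t) := by
    have hlow : Tendsto (fun j => t - ‖c j‖) atTop (𝓝 t) := by
      simpa using tendsto_const_nhds.sub hnorm
    refine tendsto_of_tendsto_of_tendsto_of_le_of_le hlow tendsto_const_nhds (fun j => ?_)
      (fun j => ?_)
    · have h1 := (Int.sub_one_lt_floor (t / ‖c j‖)).le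
      have h2 := mul_le_mul_of_nonneg_right h1 (hpos j).le
      rwa [sub_mul, div_mul_cancel₀ _ (hpos j).ne', one_mul] at h2
    · have h2 := mul_le_mul_of_nonneg_right (Int.floor_le (t / ‖c j‖)) (hpos j).le
      rwa [div_mul_cancel₀ _ (hpos j).ne'] at h2
  refine (hcoef.smul hu).congr fun j => ?_
  rw [smul_smul, mul_assoc, mul_inv_cancel₀ (hpos j).ne', mul_one, Int.cast_smul_eq_zsmul]

/-- A subspace that contains no one-parameter subgroup of a closed group `S` meets the preimage of
`S` under the exponential map only in `0`, near `0`. -/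
theorem eventually_eq_zero_of_exp_mem [FiniteDimensional ℝ 𝔸] {S : Set 𝔸} (hS : IsClosed S)
    (hpow : ∀ c : 𝔸, exp c ∈ S → ∀ k : ℤ, exp (k • c) ∈ S) (p : Submodule ℝ 𝔸)
    (hp : ∀ c ∈ p, (∀ t : ℝ, exp (t • c) ∈ S) → c = 0) :
    ∀ᶠ c in 𝓝 (0 : 𝔸), c ∈ p → exp c ∈ S → c = 0 := by
  have : CompleteSpace 𝔸 := FiniteDimensional.complete ℝ 𝔸
  have : ProperSpace 𝔸 := FiniteDimensional.proper ℝ 𝔸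
  let _ : NormedAlgebra ℚ 𝔸 := NormedAlgebra.restrictScalars ℚ ℝ 𝔸
  by_contra hcon
  rw [not_eventually] at hcon
  obtain ⟨c, hc0, hc⟩ := exists_seq_forall_of_frequently hcon
  push Not at hc
  have hdir : ∀ j, ‖c j‖⁻¹ • c j ∈ Metric.sphere (0 : 𝔸) 1 := fun j => by
    rw [mem_sphere_zero_iff_norm, norm_smul, norm_inv, norm_norm,
      inv_mul_cancel₀ (norm_ne_zero_iff.2 (hc j).2.2)]
  obtain ⟨u, hu, φ, hφ, hlim⟩ := (isCompact_sphere (0 : 𝔸) 1).tendsto_subseq hdir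
  have hup : u ∈ p := by
    refine (Submodule.closed_of_finiteDimensional p).mem_of_tendsto hlim
      (Eventually.of_forall fun j => p.smul_mem _ (hc _).1)
  -- Integer multiples of the `c j` approximate every `t • u`, and `S` is closed, so the whole
  -- one-parameter group of the unit vector `u` lies in `S`.
  have hu0 : u = 0 := by
    refine hp u hup fun t => ?_
    have hmul := tendsto_floor_smul (hc0.comp hφ.tendsto_atTop) (fun j => (hc (φ j)).2.2) hlim t
    exact hS.mem_of_tendsto ((exp_continuous.tendsto _).comp hmul)
      (Eventually.of_forall fun j => hpow _ (hc _).2.1 _)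
  simp [hu0] at hu

/-- If three subspaces span `𝔸`, then the products of their exponentials fill a neighbourhood
of `1`. -/
theorem exp_mul_exp_mul_exp_mem_nhds_one [FiniteDimensional ℝ 𝔸] {m k p : Submodule ℝ 𝔸}
    (hspan : m ⊔ k ⊔ p = ⊤) {N : Set 𝔸} (hN : N ∈ 𝓝 0) :
    {g : 𝔸 | ∃ a ∈ m, ∃ b ∈ k, ∃ c ∈ p, c ∈ N ∧ exp a * exp b * exp c = g} ∈ 𝓝 1 := by
  have : CompleteSpace 𝔸 := FiniteDimensional.complete ℝ 𝔸
  let fm : m × k × p →L[ℝ] 𝔸 := m.subtypeL ∘L ContinuousLinearMap.fst ℝ m (k × p)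
  let fk : m × k × p →L[ℝ] 𝔸 :=
    k.subtypeL ∘L ContinuousLinearMap.fst ℝ k p ∘L ContinuousLinearMap.snd ℝ m (k × p)
  let fp : m × k × p →L[ℝ] 𝔸 :=
    p.subtypeL ∘L ContinuousLinearMap.snd ℝ k p ∘L ContinuousLinearMap.snd ℝ m (k × p)
  have hexp : ∀ f : m × k × p →L[ℝ] 𝔸, HasStrictFDerivAt (fun z => exp (f z)) f 0 := fun f => by
    have h0 : HasStrictFDerivAt (exp : 𝔸 → 𝔸) (1 : 𝔸 →L[ℝ] 𝔸) (f 0) := by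
      rw [map_zero]; exact hasStrictFDerivAt_exp_zero
    exact h0.comp (0 : m × k × p) f.hasStrictFDerivAt
  -- All factors equal `1` at the origin, so the derivative there is `(a, b, c) ↦ a + b + c`, which
  -- is onto by `hspan`.
  have hder := ((hexp fm).mul' (hexp fk)).mul' (hexp fp)
  have hrange := hder.map_nhds_eq_of_surj (by
    rw [eq_top_iff, ← hspan]
    intro v hv
    obtain ⟨w, hw, c, hc, rfl⟩ := Submodule.mem_sup.1 hv
    obtain ⟨a, ha, b, hb, rfl⟩ := Submodule.mem_sup.1 hw
    refine ⟨(⟨a, ha⟩, ⟨b, hb⟩, ⟨c, hc⟩), ?_⟩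
    simp [fm, fk, fp, add_comm])
  have h1 : exp (fm 0) * exp (fk 0) * exp (fp 0) = 1 := by simp
  have hN' : fp ⁻¹' N ∈ 𝓝 (0 : m × k × p) :=
    fp.continuous.continuousAt.preimage_mem_nhds (by rwa [map_zero])
  have himg := image_mem_map (m := fun z => exp (fm z) * exp (fk z) * exp (fp z)) hN'
  rw [← h1]
  refine mem_of_superset (hrange ▸ himg) ?_
  rintro _ ⟨z, hz, rfl⟩
  exact ⟨_, z.1.2, _, z.2.1.2, _, z.2.2.2, hz, rfl⟩

end BanachAlgebra

end SphereAction

end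

noncomputable section

namespace SphereAction

open Filter Topology NormedSpace Matrix Module
open scoped Matrix.Norms.Operator

variable {n : ℕ}

/-! ### Matrix action, compactness and powers of exponentials -/

theorem mulVecE_mul (A B : Matrix (Fin n) (Fin n) ℝ) (x : EuclideanSpace ℝ (Fin n)) :
    mulVecE (A * B) x = mulVecE A (mulVecE B x) := by
  simp [mulVecE]

theorem mulVecE_one (x : EuclideanSpace ℝ (Fin n)) :
    mulVecE (1 : Matrix (Fin n) (Fin n) ℝ) x = x := by
  simp [mulVecE]

theorem continuous_mulVecE_left (x : EuclideanSpace ℝ (Fin n)) :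
    Continuous fun A : Matrix (Fin n) (Fin n) ℝ => mulVecE A x :=
  (evalAt x).continuous_of_finiteDimensional

theorem continuous_mulVecE_right (A : Matrix (Fin n) (Fin n) ℝ) :
    Continuous fun x : EuclideanSpace ℝ (Fin n) => mulVecE A x := by
  unfold mulVecE
  fun_prop

theorem mulVecE_exp_of_mulVecE_eq_zero {B : Matrix (Fin n) (Fin n) ℝ}
    {x : EuclideanSpace ℝ (Fin n)} (hB : mulVecE B x = 0) : mulVecE (exp B) x = x := by
  have hsum := (exp_series_hasSum_exp' (𝕂 := ℝ) B).map (evalAt x) (continuous_mulVecE_left x)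
  refine hsum.unique ?_
  have hzero : ∀ j, j ≠ 0 →
      (evalAt x ∘ fun j : ℕ => ((j.factorial : ℝ)⁻¹) • B ^ j) j = 0 := by
    intro j hj
    obtain ⟨i, rfl⟩ := Nat.exists_eq_succ_of_ne_zero hj
    have : evalAt x (B ^ (i + 1)) = 0 := by
      change mulVecE _ x = 0
      rw [pow_succ, mulVecE_mul, hB]
      simp [mulVecE]
    simp [this]
  have hone : evalAt x 1 = x := mulVecE_one x
  simpa [hone] using hasSum_single 0 hzero

theorem isCompact_specialOrthogonalGroup :
    IsCompact (Matrix.specialOrthogonalGroup (Fin n) ℝ : Set (Matrix (Fin n) (Fin n) ℝ)) := by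
  have hbox : IsCompact (Set.univ.pi fun _ => Set.univ.pi fun _ => Metric.closedBall 0 1 :
      Set (Fin n → Fin n → ℝ)) :=
    isCompact_univ_pi fun _ => isCompact_univ_pi fun _ => isCompact_closedBall 0 1
  refine IsCompact.of_isClosed_subset (X := Matrix (Fin n) (Fin n) ℝ) hbox ?_ fun A hA => ?_
  · have hset : (Matrix.specialOrthogonalGroup (Fin n) ℝ : Set (Matrix (Fin n) (Fin n) ℝ)) =
        {A | A * Aᵀ = 1} ∩ {A | A.det = 1} := by
      ext A
      simp [Matrix.mem_specialOrthogonalGroup_iff, Matrix.mem_orthogonalGroup_iff]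
    rw [hset]
    refine IsClosed.inter (isClosed_eq ?_ continuous_const) (isClosed_eq ?_ continuous_const)
    · exact continuous_id.matrix_mul continuous_id.matrix_transpose
    · exact continuous_id.matrix_det
  · intro i _ j _
    rw [mem_closedBall_zero_iff]
    exact entry_norm_bound_of_unitary (Matrix.mem_specialOrthogonalGroup_iff.1 hA).1 i j

instance : CompactSpace (SO n) := isCompact_iff_compactSpace.1 isCompact_specialOrthogonalGroup

theorem isClosed_image_coe {H : Subgroup (SO n)} (hH : IsClosed (H : Set (SO n))) :
    IsClosed ((fun g : SO n => (g : Matrix (Fin n) (Fin n) ℝ)) '' (H : Set (SO n))) :=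
  (hH.isCompact.image continuous_subtype_val).isClosed

theorem coe_inv_eq_exp_neg {g : SO n} {A : Matrix (Fin n) (Fin n) ℝ}
    (hg : (g : Matrix (Fin n) (Fin n) ℝ) = exp A) :
    ((g⁻¹ : SO n) : Matrix (Fin n) (Fin n) ℝ) = exp (-A) := by
  rw [Matrix.exp_neg]
  refine (Matrix.inv_eq_right_inv ?_).symm
  rw [← hg, ← Submonoid.coe_mul, mul_inv_cancel, Submonoid.coe_one]

theorem coe_zpow_eq_exp_zsmul {g : SO n} {A : Matrix (Fin n) (Fin n) ℝ}
    (hg : (g : Matrix (Fin n) (Fin n) ℝ) = exp A) (k : ℤ) :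
    ((g ^ k : SO n) : Matrix (Fin n) (Fin n) ℝ) = exp (k • A) := by
  have hnat : ∀ j : ℕ, ((g ^ j : SO n) : Matrix (Fin n) (Fin n) ℝ) = exp (j • A) := fun j => by
    rw [SubmonoidClass.coe_pow, hg, Matrix.exp_nsmul]
  obtain ⟨j, rfl | rfl⟩ := k.eq_nat_or_neg
  · simpa using hnat j
  · rw [_root_.zpow_neg, zpow_natCast, coe_inv_eq_exp_neg (hnat j), neg_smul, natCast_zsmul]

theorem IsLieAlgebraOf.exists_coe_eq_exp {h : LieSubalgebra ℝ (Matrix (Fin n) (Fin n) ℝ)}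
    {H : Subgroup (SO n)} (hH : IsLieAlgebraOf h H) {A : Matrix (Fin n) (Fin n) ℝ} (hA : A ∈ h) :
    ∃ g ∈ H, (g : Matrix (Fin n) (Fin n) ℝ) = exp A := by
  simpa using (hH A).1 hA 1

/-! ### Transitivity forces full rank -/

/-- Near `1`, an element of `H` moves `x` like the exponential of an element of `m`, where `m` is
a complement in the Lie algebra of a subspace annihilating `x`. -/
theorem exists_nhds_forall_mulVecE_eq_exp {h : LieSubalgebra ℝ (Matrix (Fin n) (Fin n) ℝ)}
    {H : Subgroup (SO n)} (hcl : IsClosed (H : Set (SO n))) (hH : IsLieAlgebraOf h H)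
    (x : EuclideanSpace ℝ (Fin n)) {m k : Submodule ℝ (Matrix (Fin n) (Fin n) ℝ)}
    (hmk : m ⊔ k = h.toSubmodule) (hk : ∀ B ∈ k, mulVecE B x = 0) :
    ∃ U ∈ 𝓝 (1 : Matrix (Fin n) (Fin n) ℝ), ∀ g ∈ H, (g : Matrix (Fin n) (Fin n) ℝ) ∈ U →
      ∃ A ∈ m, mulVecE g x = mulVecE (exp A) x := by
  obtain ⟨p, hp⟩ := exists_isCompl h.toSubmodule
  let S : Set (Matrix (Fin n) (Fin n) ℝ) :=
    (fun g : SO n => (g : Matrix (Fin n) (Fin n) ℝ)) '' (H : Set (SO n))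
  have hisol : ∀ᶠ C in 𝓝 (0 : Matrix (Fin n) (Fin n) ℝ), C ∈ p → exp C ∈ S → C = 0 := by
    refine eventually_eq_zero_of_exp_mem (isClosed_image_coe hcl) ?_ p ?_
    · rintro C ⟨g, hg, hgC⟩ j
      exact ⟨g ^ j, H.zpow_mem hg j, coe_zpow_eq_exp_zsmul hgC j⟩
    · intro C hC hexp
      exact Submodule.disjoint_def.1 hp.disjoint C ((hH C).2 hexp) hC
  refine ⟨_, exp_mul_exp_mul_exp_mem_nhds_one (m := m) (k := k) (p := p)
    (by rw [hmk]; exact hp.sup_eq_top) hisol, ?_⟩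
  rintro g hg ⟨A, hA, B, hB, C, hC, hCN, hprod'⟩
  have hprod : exp A * exp B * exp C = (g : Matrix (Fin n) (Fin n) ℝ) := hprod'
  obtain ⟨a, haH, ha⟩ := hH.exists_coe_eq_exp (hmk.le (Submodule.mem_sup_left hA))
  obtain ⟨b, hbH, hb⟩ := hH.exists_coe_eq_exp (hmk.le (Submodule.mem_sup_right hB))
  -- `exp A` and `exp B` come from `H`, hence so does `exp C`, and `hisol` applies.
  have hC0 : C = 0 := by
    refine hCN hC ⟨(a * b)⁻¹ * g, H.mul_mem (H.inv_mem (H.mul_mem haH hbH)) hg, ?_⟩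
    change (((a * b)⁻¹ * g : SO n) : Matrix (Fin n) (Fin n) ℝ) = exp C
    rw [Submonoid.coe_mul, ← hprod, ← ha, ← hb, ← Submonoid.coe_mul, ← mul_assoc,
      ← Submonoid.coe_mul, inv_mul_cancel, Submonoid.coe_one, one_mul]
  refine ⟨A, hA, ?_⟩
  rw [← hprod, hC0, NormedSpace.exp_zero, mul_one, mulVecE_mul,
    mulVecE_exp_of_mulVecE_eq_zero (hk B hB)]

/-- A C¹ image has Hausdorff dimension at most that of its source. The radial factor `z.1` lets
these sets cover ℝⁿ, so the dimension of the sphere is not needed. -/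
theorem dimH_range_smul_mulVecE_le (m : Submodule ℝ (Matrix (Fin n) (Fin n) ℝ))
    (g : Matrix (Fin n) (Fin n) ℝ) (x : EuclideanSpace ℝ (Fin n)) :
    dimH (Set.range fun z : ℝ × m => z.1 • mulVecE (g * exp (z.2 : Matrix (Fin n) (Fin n) ℝ)) x) ≤
      (1 + finrank ℝ m : ℕ) := by
  have hexp : ContDiff ℝ 1 (exp : Matrix (Fin n) (Fin n) ℝ → Matrix (Fin n) (Fin n) ℝ) :=
    contDiff_iff_contDiffAt.2 fun A => (exp_analytic (𝕂 := ℝ) A).contDiffAt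
  have hsmooth : ContDiff ℝ 1 fun z : ℝ × m =>
      z.1 • mulVecE (g * exp (z.2 : Matrix (Fin n) (Fin n) ℝ)) x := by
    refine contDiff_fst.smul ?_
    refine (LinearMap.toContinuousLinearMap (evalAt x)).contDiff.comp (contDiff_const.mul ?_)
    exact hexp.comp (m.subtypeL.contDiff.comp contDiff_snd)
  refine hsmooth.dimH_range_le.trans (le_of_eq ?_)
  rw [finrank_prod, finrank_self]

/-- If `h` splits as `m ⊔ k` with `k` annihilating `x` and the orbit of `x` is the whole sphere,
then `m` has dimension at least `n - 1`. -/
theorem le_one_add_finrank_of_isPretransitive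
    {h : LieSubalgebra ℝ (Matrix (Fin n) (Fin n) ℝ)}
    {H : Subgroup (SO n)} (hcl : IsClosed (H : Set (SO n))) (hH : IsLieAlgebraOf h H)
    [MulAction.IsPretransitive H (Sphere n)]
    (x : Sphere n) {m k : Submodule ℝ (Matrix (Fin n) (Fin n) ℝ)}
    (hmk : m ⊔ k = h.toSubmodule) (hk : ∀ B ∈ k, mulVecE B (x : EuclideanSpace ℝ (Fin n)) = 0) :
    n ≤ 1 + finrank ℝ m := by
  obtain ⟨U, hU, hUx⟩ := exists_nhds_forall_mulVecE_eq_exp hcl hH x.1 hmk hk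
  have : CompactSpace H := isCompact_iff_compactSpace.1 hcl.isCompact
  let f : H → Set H := fun d => {g | ((d⁻¹ * g : H) : Matrix (Fin n) (Fin n) ℝ) ∈ U}
  have hf : ∀ d, f d ∈ 𝓝 d := fun d => by
    have hcont : Continuous fun g : H =>
        (((d⁻¹ : H) : SO n) : Matrix (Fin n) (Fin n) ℝ) * ((g : SO n) : Matrix (Fin n) (Fin n) ℝ) :=
      continuous_const.mul (continuous_subtype_val.comp continuous_subtype_val)
    refine hcont.continuousAt.preimage_mem_nhds ?_
    rwa [← Submonoid.coe_mul, ← Subgroup.coe_mul, inv_mul_cancel, Subgroup.coe_one,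
      Submonoid.coe_one]
  -- A countable cover suffices, since `dimH` of a countable union is the supremum.
  obtain ⟨D, hD, hcover⟩ := countable_cover_nhds_of_sigmaCompact hf
  have := hD.to_subtype
  let R : D → Set (EuclideanSpace ℝ (Fin n)) := fun d =>
    Set.range fun z : ℝ × m =>
      z.1 • mulVecE ((((d : H) : SO n) : Matrix (Fin n) (Fin n) ℝ) * exp (z.2 : Matrix (Fin n) (Fin n) ℝ)) x.1
  have hR : ⋃ d, R d = Set.univ := by
    refine Set.eq_univ_of_forall fun y => ?_
    obtain ⟨g, hg⟩ : ∃ g : H, ‖y‖ • mulVecE ((g : SO n) : Matrix (Fin n) (Fin n) ℝ) x.1 = y := by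
      rcases eq_or_ne y 0 with rfl | hy
      · exact ⟨1, by simp⟩
      · obtain ⟨g, hg⟩ := MulAction.exists_smul_eq H x
          (⟨‖y‖⁻¹ • y, by simp [norm_smul, hy]⟩ : Sphere n)
        refine ⟨g, ?_⟩
        have hg' : mulVecE ((g : SO n) : Matrix (Fin n) (Fin n) ℝ) x.1 = ‖y‖⁻¹ • y :=
          congrArg Subtype.val hg
        rw [hg', smul_smul, mul_inv_cancel₀ (norm_ne_zero_iff.2 hy), one_smul]
    obtain ⟨d, hdD, hgd⟩ := Set.mem_iUnion₂.1 (hcover.ge (Set.mem_univ g))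
    obtain ⟨A, hA, hAx⟩ := hUx _ (d⁻¹ * g).2 hgd
    refine Set.mem_iUnion.2 ⟨⟨d, hdD⟩, (‖y‖, ⟨A, hA⟩), ?_⟩
    dsimp only
    rw [mulVecE_mul, ← hAx, ← mulVecE_mul, ← Submonoid.coe_mul, ← Subgroup.coe_mul,
      mul_inv_cancel_left, hg]
  have hdim : dimH (⋃ d, R d) ≤ (1 + finrank ℝ m : ℕ) := by
    rw [dimH_iUnion]
    exact iSup_le fun d => dimH_range_smul_mulVecE_le m _ x.1
  rw [hR, Real.dimH_univ_eq_finrank, finrank_euclideanSpace_fin] at hdim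
  exact_mod_cast hdim

/-- With `k` the kernel of evaluation at `x` inside `h`, evaluation is injective on a complement
`m`. -/
theorem exists_sup_eq_of_finrank_le_rankAt (h : LieSubalgebra ℝ (Matrix (Fin n) (Fin n) ℝ))
    (x : EuclideanSpace ℝ (Fin n)) :
    ∃ m k : Submodule ℝ (Matrix (Fin n) (Fin n) ℝ), m ⊔ k = h.toSubmodule ∧
      (∀ B ∈ k, mulVecE B x = 0) ∧ finrank ℝ m ≤ rankAt h x := by
  obtain ⟨q, hq⟩ := exists_isCompl (h.toSubmodule ⊓ LinearMap.ker (evalAt x))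
  refine ⟨h.toSubmodule ⊓ q, h.toSubmodule ⊓ LinearMap.ker (evalAt x), ?_, fun B hB => hB.2, ?_⟩
  · rw [sup_comm, inf_comm h.toSubmodule q, ← sup_inf_assoc_of_le q inf_le_left, hq.sup_eq_top,
      top_inf_eq]
  · let f : (h.toSubmodule ⊓ q : Submodule ℝ _) →ₗ[ℝ] Submodule.map (evalAt x) h.toSubmodule :=
      (evalAt x).restrict fun A hA => Submodule.mem_map_of_mem hA.1
    refine LinearMap.finrank_le_finrank_of_injective (f := f) ?_
    rw [← LinearMap.ker_eq_bot, LinearMap.ker_eq_bot']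
    intro A hA
    have hAx : evalAt x A = 0 := congrArg Subtype.val hA
    exact Subtype.ext (Submodule.disjoint_def.1 hq.disjoint A ⟨A.2.1, hAx⟩ A.2.2)

theorem map_evalAt_le_orthogonal {h : LieSubalgebra ℝ (Matrix (Fin n) (Fin n) ℝ)}
    (hso : h ≤ LieAlgebra.Orthogonal.so (Fin n) ℝ) (x : EuclideanSpace ℝ (Fin n)) :
    Submodule.map (evalAt x) h.toSubmodule ≤ (Submodule.span ℝ {x})ᗮ := by
  rintro _ ⟨A, hA, rfl⟩
  have hskew : Aᵀ = -A := (LieAlgebra.Orthogonal.mem_so _ _ A).1 (hso hA)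
  rw [Submodule.mem_orthogonal_singleton_iff_inner_right]
  have h1 : inner ℝ x (evalAt x A) = x.ofLp ⬝ᵥ (A *ᵥ x.ofLp) := by
    rw [EuclideanSpace.inner_eq_star_dotProduct, dotProduct_comm]
    rfl
  have h2 : x.ofLp ⬝ᵥ (A *ᵥ x.ofLp) = -(x.ofLp ⬝ᵥ (A *ᵥ x.ofLp)) := by
    conv_lhs => rw [dotProduct_mulVec, ← mulVec_transpose, hskew, neg_mulVec, neg_dotProduct,
      dotProduct_comm]
  rw [h1]
  linarith

theorem finrank_orthogonal_span_unit (x : Sphere n) :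
    finrank ℝ (Submodule.span ℝ {(x : EuclideanSpace ℝ (Fin n))})ᗮ = n - 1 := by
  have hx : (x : EuclideanSpace ℝ (Fin n)) ≠ 0 := ne_zero_of_mem_unit_sphere x
  have h1 := (Submodule.span ℝ {(x : EuclideanSpace ℝ (Fin n))}).finrank_add_finrank_orthogonal
  rw [finrank_span_singleton hx, finrank_euclideanSpace_fin] at h1
  omega

theorem rankAt_le {h : LieSubalgebra ℝ (Matrix (Fin n) (Fin n) ℝ)}
    (hso : h ≤ LieAlgebra.Orthogonal.so (Fin n) ℝ) (x : Sphere n) :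
    rankAt h (x : EuclideanSpace ℝ (Fin n)) ≤ n - 1 :=
  (Submodule.finrank_mono (map_evalAt_le_orthogonal hso x.1)).trans_eq
    (finrank_orthogonal_span_unit x)

theorem rankAt_eq_of_isPretransitive {h : LieSubalgebra ℝ (Matrix (Fin n) (Fin n) ℝ)}
    (hso : h ≤ LieAlgebra.Orthogonal.so (Fin n) ℝ)
    {H : Subgroup (SO n)} (hcl : IsClosed (H : Set (SO n))) (hH : IsLieAlgebraOf h H)
    [MulAction.IsPretransitive H (Sphere n)] (x : Sphere n) :
    rankAt h (x : EuclideanSpace ℝ (Fin n)) = n - 1 := by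
  obtain ⟨m, k, hmk, hk, hm⟩ := exists_sup_eq_of_finrank_le_rankAt h x.1
  have := le_one_add_finrank_of_isPretransitive hcl hH x hmk hk
  exact le_antisymm (rankAt_le hso x) (by omega)

/-! ### Full rank gives transitivity -/

theorem span_sup_map_evalAt_eq_top {h : LieSubalgebra ℝ (Matrix (Fin n) (Fin n) ℝ)}
    (hso : h ≤ LieAlgebra.Orthogonal.so (Fin n) ℝ) {x : Sphere n}
    (hx : rankAt h (x : EuclideanSpace ℝ (Fin n)) = n - 1) :
    Submodule.span ℝ {(x : EuclideanSpace ℝ (Fin n))} ⊔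
      Submodule.map (evalAt (x : EuclideanSpace ℝ (Fin n))) h.toSubmodule = ⊤ := by
  have heq := Submodule.eq_of_le_of_finrank_eq (map_evalAt_le_orthogonal hso x.1)
    (by rw [finrank_orthogonal_span_unit]; exact hx)
  rw [heq]
  exact Submodule.sup_orthogonal_of_hasOrthogonalProjection

/-- If `x` and `{A x : A ∈ h}` span the space, then the cone over `exp(h) x` is a neighbourhood
of `x`. -/
theorem cone_exp_mem_nhds {h : Submodule ℝ (Matrix (Fin n) (Fin n) ℝ)}
    {x : EuclideanSpace ℝ (Fin n)}
    (hspan : Submodule.span ℝ {x} ⊔ Submodule.map (evalAt x) h = ⊤) :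
    {y | ∃ s : ℝ, 0 < s ∧ ∃ A ∈ h, s • mulVecE (exp A) x = y} ∈ 𝓝 x := by
  let e := LinearMap.toContinuousLinearMap (evalAt x)
  have hexp : HasStrictFDerivAt (fun z : ℝ × h => exp (z.2 : Matrix (Fin n) (Fin n) ℝ))
      (h.subtypeL ∘L ContinuousLinearMap.snd ℝ ℝ h) (1, 0) := by
    have h0 : HasStrictFDerivAt
        (exp : Matrix (Fin n) (Fin n) ℝ → Matrix (Fin n) (Fin n) ℝ)
        (1 : Matrix (Fin n) (Fin n) ℝ →L[ℝ] Matrix (Fin n) (Fin n) ℝ)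
        ((h.subtypeL ∘L ContinuousLinearMap.snd ℝ ℝ h) (1, 0)) := by
      have : (h.subtypeL ∘L ContinuousLinearMap.snd ℝ ℝ h) (1, 0) = 0 := by simp
      rw [this]
      exact hasStrictFDerivAt_exp_zero
    exact h0.comp ((1, 0) : ℝ × h) (h.subtypeL ∘L ContinuousLinearMap.snd ℝ ℝ h).hasStrictFDerivAt
  have hder := (hasStrictFDerivAt_fst (𝕜 := ℝ) (p := ((1, 0) : ℝ × h))).smul
    (e.hasStrictFDerivAt.comp ((1, 0) : ℝ × h) hexp)
  -- The derivative at `(1, 0)` is `(s, A) ↦ s x + A x`, onto by `hspan`.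
  have hmap := hder.map_nhds_eq_of_surj (by
    rw [eq_top_iff, ← hspan]
    intro v hv
    obtain ⟨w, hw, _, ⟨A, hA, rfl⟩, rfl⟩ := Submodule.mem_sup.1 hv
    obtain ⟨s, rfl⟩ := Submodule.mem_span_singleton.1 hw
    refine ⟨(s, ⟨A, hA⟩), ?_⟩
    change (1 : ℝ) • evalAt x A + s • mulVecE (exp ((0 : h) : Matrix (Fin n) (Fin n) ℝ)) x = _
    rw [ZeroMemClass.coe_zero, NormedSpace.exp_zero, mulVecE_one, one_smul, add_comm])
  have hN : {z : ℝ × h | 0 < z.1} ∈ 𝓝 ((1, 0) : ℝ × h) :=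
    (isOpen_lt continuous_const continuous_fst).mem_nhds
      (show (0 : ℝ) < 1 from one_pos)
  have hx : (1 : ℝ) • mulVecE (exp ((0 : h) : Matrix (Fin n) (Fin n) ℝ)) x = x := by
    rw [ZeroMemClass.coe_zero, NormedSpace.exp_zero, mulVecE_one, one_smul]
  replace hmap := hmap.trans (congrArg 𝓝 hx)
  rw [← hmap]
  refine mem_of_superset (image_mem_map hN) ?_
  rintro _ ⟨z, hz, rfl⟩
  exact ⟨z.1, hz, z.2, z.2.2, rfl⟩

theorem continuous_smul_sphere (g : SO n) : Continuous fun y : Sphere n => g • y :=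
  ((continuous_mulVecE_right _).comp continuous_subtype_val).subtype_mk _

theorem isClosed_orbit {H : Subgroup (SO n)} (hcl : IsClosed (H : Set (SO n))) (x : Sphere n) :
    IsClosed (MulAction.orbit H x) := by
  have : CompactSpace H := isCompact_iff_compactSpace.1 hcl.isCompact
  have hcont : Continuous fun g : H => g • x :=
    ((continuous_mulVecE_left x.1).comp
      (continuous_subtype_val.comp continuous_subtype_val)).subtype_mk _
  exact (isCompact_range hcont).isClosed

theorem isOpen_orbit_of_mem_nhds {H : Subgroup (SO n)} {x : Sphere n}
    (hx : MulAction.orbit H x ∈ 𝓝 x) : IsOpen (MulAction.orbit H x) := by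
  rw [isOpen_iff_mem_nhds]
  rintro _ ⟨g, rfl⟩
  have hpre : (fun y : Sphere n => ((g⁻¹ : H) : SO n) • y) ⁻¹' MulAction.orbit H x ∈ 𝓝 (g • x) := by
    refine (continuous_smul_sphere _).continuousAt.preimage_mem_nhds ?_
    change MulAction.orbit H x ∈ 𝓝 (g⁻¹ • g • x)
    rwa [inv_smul_smul]
  refine mem_of_superset hpre fun y hy => ?_
  exact MulAction.mem_orbit_iff.2 (by
    obtain ⟨k, hk⟩ := hy
    exact ⟨g * k, by rw [mul_smul, smul_eq_iff_eq_inv_smul]; exact hk⟩)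

theorem orbit_mem_nhds_of_rankAt_eq {h : LieSubalgebra ℝ (Matrix (Fin n) (Fin n) ℝ)}
    (hso : h ≤ LieAlgebra.Orthogonal.so (Fin n) ℝ) {H : Subgroup (SO n)}
    (hH : IsLieAlgebraOf h H) {x : Sphere n}
    (hx : rankAt h (x : EuclideanSpace ℝ (Fin n)) = n - 1) : MulAction.orbit H x ∈ 𝓝 x := by
  have hcone := cone_exp_mem_nhds (span_sup_map_evalAt_eq_top hso hx)
  refine mem_of_superset (continuous_subtype_val.continuousAt.preimage_mem_nhds hcone) ?_
  rintro y ⟨s, hs, A, hA, hy⟩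
  obtain ⟨g, hgH, hg⟩ := hH.exists_coe_eq_exp hA
  rw [← hg] at hy
  -- `y` and `g x` are both unit vectors, so the cone meets the sphere only in orbit points.
  have hs1 : s = 1 := by
    have hnorm := congrArg norm hy
    rw [norm_smul, norm_mulVecE, norm_eq_of_mem_sphere, norm_eq_of_mem_sphere, mul_one,
      Real.norm_of_nonneg hs.le] at hnorm
    exact hnorm
  rw [hs1, one_smul] at hy
  exact ⟨⟨g, hgH⟩, Subtype.ext hy⟩

theorem isPretransitive_of_rankAt_eq (hn : 2 ≤ n)
    {h : LieSubalgebra ℝ (Matrix (Fin n) (Fin n) ℝ)}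
    (hso : h ≤ LieAlgebra.Orthogonal.so (Fin n) ℝ) {H : Subgroup (SO n)}
    (hcl : IsClosed (H : Set (SO n))) (hH : IsLieAlgebraOf h H) {x : Sphere n}
    (hx : rankAt h (x : EuclideanSpace ℝ (Fin n)) = n - 1) :
    MulAction.IsPretransitive H (Sphere n) := by
  have : PreconnectedSpace (Sphere n) := by
    refine Subtype.preconnectedSpace (isPreconnected_sphere ?_ 0 1)
    rw [← finrank_eq_rank, finrank_euclideanSpace_fin]
    exact_mod_cast hn
  rw [MulAction.isPretransitive_iff_orbit_eq_univ x]
  exact IsClopen.eq_univ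
    ⟨isClosed_orbit hcl x, isOpen_orbit_of_mem_nhds (orbit_mem_nhds_of_rankAt_eq hso hH hx)⟩
    ⟨x, MulAction.mem_orbit_self x⟩

end SphereAction

end

theorem mainTheorem7 (n : ℕ) (hn : 2 ≤ n)
    (h : LieSubalgebra ℝ (Matrix (Fin n) (Fin n) ℝ))
    (h_so : h ≤ LieAlgebra.Orthogonal.so (Fin n) ℝ)
    (H : Subgroup (SphereAction.SO n))
    (H_closed : IsClosed (H : Set (SphereAction.SO n)))
    (h_H : SphereAction.IsLieAlgebraOf h H) :
    MulAction.IsPretransitive H (SphereAction.Sphere n) ↔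
      ∃ x : SphereAction.Sphere n,
        SphereAction.rankAt h (x : EuclideanSpace ℝ (Fin n)) = n - 1 := by
  constructor
  · intro _
    have : NeZero n := ⟨by omega⟩
    exact ⟨⟨EuclideanSpace.single 0 1, by simp⟩,
      SphereAction.rankAt_eq_of_isPretransitive h_so H_closed h_H _⟩
  · rintro ⟨x, hx⟩
    exact SphereAction.isPretransitive_of_rankAt_eq hn h_so H_closed h_H hx
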